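/- **Theorem (Noninterference for Moggi's monadic metalanguage).** Fix a collection of uninterpreted base types $b$ (with no constants). The types are $$A,B ::= b \mid \mathsf{unit} \mid \mathsf{Bool} \mid A\times B \mid \mathsf{empty} \mid A+B \mid A\to B \mid TA .$$ The terms are those of the simply typed $\lambda$-calculus with the usual introduction and elimination forms for functions, products, $\mathsf{unit}$, $\mathsf{empty}$ and sums, together with the constants $\mathtt{tt},\mathtt{ff}:\mathsf{Bool}$, the conditional, and the two monadic constructs: $$\frac{\Gamma\vdash M:\mathsf{Bool}\quad \Gamma\vdash E_1:C\quad \Gamma\vdash E_0:C}{\Gamma\vdash \mathsf{if}\ M\ \mathsf{then}\ E_1\ \mathsf{else}\ E_0:C}\qquad \frac{\Gamma\vdash M:A}{\Gamma\vdash [M]:TA}\qquad \frac{\Gamma\vdash M:TA\quad \Gamma,x:A\vdash N:TB}{\Gamma\vdash \mathsf{let}\ x=M\ \mathsf{in}\ N:TB}.$$ The equational theory $\Gamma\vdash M=N:A$ is the least typed congruence (an equivalence relation compatible with all term formers, including under binders) that contains the usual $\beta$- and $\eta$-equations for functions, products, $\mathsf{unit}$ and finite coproducts ($\mathsf{empty}$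 and $+$), the two equations $$\mathsf{if}\ \mathtt{tt}\ \mathsf{then}\ E_1\ \mathsf{else}\ E_0 = E_1,\qquad \mathsf{if}\ \mathtt{ff}\ \mathsf{then}\ E_1\ \mathsf{else}\ E_0 = E_0,$$ and the monad equations $$\mathsf{let}\ x=[M]\ \mathsf{in}\ N = N[M/x],\qquad \mathsf{let}\ x=M\ \mathsf{in}\ [x] = M,$$ $$\mathsf{let}\ y=(\mathsf{let}\ x=M\ \mathsf{in}\ N)\ \mathsf{in}\ P \;=\; \mathsf{let}\ x=M\ \mathsf{in}\ (\mathsf{let}\ y=N\ \mathsf{in}\ P)\quad (x\notin \mathrm{fv}(P)).$$ Let $A$ be a type for which there exists a closed term of type $A$. If $x:TA\vdash M:\mathsf{Bool}$, then for all closed terms $\vdash E:TA$ and $\vdash E':TA$, $$\vdash M[E/x]=M[E'/x]:\mathsf{Bool}.$$ -/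

import Mathlib

namespace MonadicMetalanguage

universe u

/-- Types of the monadic metalanguage over a collection `Base` of uninterpreted base types:
base types, unit, booleans, products, finite coproducts, functions and computation types. -/
inductive Ty (Base : Type u) : Type u
  | base (b : Base) : Ty Base
  | unit : Ty Base
  | bool : Ty Base
  | prod (A B : Ty Base) : Ty Base
  | empty : Ty Base
  | sum (A B : Ty Base) : Ty Base
  | arrow (A B : Ty Base) : Ty Base
  | T (A : Ty Base) : Ty Base

/-- Typing contexts; variables are de Bruijn indices, the most recent one at the head. -/
abbrev Ctx (Base : Type u) : Type u := List (Ty Base)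

/-- `Var Γ A`: the variables of type `A` declared in `Γ`. -/
inductive Var {Base : Type u} : Ctx Base → Ty Base → Type u
  | zero {Γ : Ctx Base} {A : Ty Base} : Var (A :: Γ) A
  | succ {Γ : Ctx Base} {A B : Ty Base} (v : Var Γ A) : Var (B :: Γ) A

/-- `Tm Γ A`: the well-typed terms `Γ ⊢ M : A` (up to renaming of bound variables).
Each constructor is a typing rule. -/
inductive Tm {Base : Type u} : Ctx Base → Ty Base → Type u
  | var {Γ : Ctx Base} {A : Ty Base} (v : Var Γ A) : Tm Γ A
  /-- The element of the unit type. -/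
  | star {Γ : Ctx Base} : Tm Γ Ty.unit
  | tt {Γ : Ctx Base} : Tm Γ Ty.bool
  | ff {Γ : Ctx Base} : Tm Γ Ty.bool
  /-- `ifte M E₁ E₀` is `if M then E₁ else E₀`. -/
  | ifte {Γ : Ctx Base} {C : Ty Base} (M : Tm Γ Ty.bool) (E₁ E₀ : Tm Γ C) : Tm Γ C
  | pair {Γ : Ctx Base} {A B : Ty Base} (M : Tm Γ A) (N : Tm Γ B) : Tm Γ (Ty.prod A B)
  | fst {Γ : Ctx Base} {A B : Ty Base} (M : Tm Γ (Ty.prod A B)) : Tm Γ A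
  | snd {Γ : Ctx Base} {A B : Ty Base} (M : Tm Γ (Ty.prod A B)) : Tm Γ B
  /-- Elimination of the empty type. -/
  | absurd {Γ : Ctx Base} {C : Ty Base} (M : Tm Γ Ty.empty) : Tm Γ C
  | inl {Γ : Ctx Base} {A B : Ty Base} (M : Tm Γ A) : Tm Γ (Ty.sum A B)
  | inr {Γ : Ctx Base} {A B : Ty Base} (M : Tm Γ B) : Tm Γ (Ty.sum A B)
  /-- `caseOf M N P` is `case M of inl x → N | inr y → P`. -/
  | caseOf {Γ : Ctx Base} {A B C : Ty Base} (M : Tm Γ (Ty.sum A B))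
      (N : Tm (A :: Γ) C) (P : Tm (B :: Γ) C) : Tm Γ C
  | lam {Γ : Ctx Base} {A B : Ty Base} (M : Tm (A :: Γ) B) : Tm Γ (Ty.arrow A B)
  | app {Γ : Ctx Base} {A B : Ty Base} (M : Tm Γ (Ty.arrow A B)) (N : Tm Γ A) : Tm Γ B
  /-- `val M` is the trivial computation `[M]`. -/
  | val {Γ : Ctx Base} {A : Ty Base} (M : Tm Γ A) : Tm Γ (Ty.T A)
  /-- `letIn M N` is `let x = M in N`. -/
  | letIn {Γ : Ctx Base} {A B : Ty Base} (M : Tm Γ (Ty.T A))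
      (N : Tm (A :: Γ) (Ty.T B)) : Tm Γ (Ty.T B)

/-- Renamings of the variables of `Γ` by variables of `Δ`. -/
abbrev Ren {Base : Type u} (Γ Δ : Ctx Base) : Type u := ∀ A : Ty Base, Var Γ A → Var Δ A

/-- Simultaneous substitutions of terms over `Δ` for the variables of `Γ`. -/
abbrev Sub {Base : Type u} (Γ Δ : Ctx Base) : Type u := ∀ A : Ty Base, Var Γ A → Tm Δ A

/-- Extension of a renaming under a binder. -/
def Ren.lift {Base : Type u} {Γ Δ : Ctx Base} (ρ : Ren Γ Δ) (B : Ty Base) :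
    Ren (B :: Γ) (B :: Δ)
  | _, .zero => .zero
  | _, .succ v => .succ (ρ _ v)

/-- The weakening renaming. -/
def Ren.wk {Base : Type u} {Γ : Ctx Base} (B : Ty Base) : Ren Γ (B :: Γ) := fun _ v => .succ v

/-- The action of renamings on terms. -/
def Tm.rename {Base : Type u} : {Γ Δ : Ctx Base} → {A : Ty Base} → Ren Γ Δ → Tm Γ A → Tm Δ A
  | _, _, _, ρ, .var v => .var (ρ _ v)
  | _, _, _, _, .star => .star
  | _, _, _, _, .tt => .tt
  | _, _, _, _, .ff => .ff
  | _, _, _, ρ, .ifte M E₁ E₀ => .ifte (M.rename ρ) (E₁.rename ρ) (E₀.rename ρ)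
  | _, _, _, ρ, .pair M N => .pair (M.rename ρ) (N.rename ρ)
  | _, _, _, ρ, .fst M => .fst (M.rename ρ)
  | _, _, _, ρ, .snd M => .snd (M.rename ρ)
  | _, _, _, ρ, .absurd M => .absurd (M.rename ρ)
  | _, _, _, ρ, .inl M => .inl (M.rename ρ)
  | _, _, _, ρ, .inr M => .inr (M.rename ρ)
  | _, _, _, ρ, .caseOf M N P =>
      .caseOf (M.rename ρ) (N.rename (Ren.lift ρ _)) (P.rename (Ren.lift ρ _))
  | _, _, _, ρ, .lam M => .lam (M.rename (Ren.lift ρ _))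
  | _, _, _, ρ, .app M N => .app (M.rename ρ) (N.rename ρ)
  | _, _, _, ρ, .val M => .val (M.rename ρ)
  | _, _, _, ρ, .letIn M N => .letIn (M.rename ρ) (N.rename (Ren.lift ρ _))

/-- Extension of a substitution under a binder. -/
def Sub.lift {Base : Type u} {Γ Δ : Ctx Base} (σ : Sub Γ Δ) (B : Ty Base) :
    Sub (B :: Γ) (B :: Δ)
  | _, .zero => .var .zero
  | _, .succ v => (σ _ v).rename (Ren.wk B)

/-- Capture-avoiding simultaneous substitution. -/
def Tm.subst {Base : Type u} : {Γ Δ : Ctx Base} → {A : Ty Base} → Sub Γ Δ → Tm Γ A → Tm Δ A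
  | _, _, _, σ, .var v => σ _ v
  | _, _, _, _, .star => .star
  | _, _, _, _, .tt => .tt
  | _, _, _, _, .ff => .ff
  | _, _, _, σ, .ifte M E₁ E₀ => .ifte (M.subst σ) (E₁.subst σ) (E₀.subst σ)
  | _, _, _, σ, .pair M N => .pair (M.subst σ) (N.subst σ)
  | _, _, _, σ, .fst M => .fst (M.subst σ)
  | _, _, _, σ, .snd M => .snd (M.subst σ)
  | _, _, _, σ, .absurd M => .absurd (M.subst σ)
  | _, _, _, σ, .inl M => .inl (M.subst σ)
  | _, _, _, σ, .inr M => .inr (M.subst σ)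
  | _, _, _, σ, .caseOf M N P =>
      .caseOf (M.subst σ) (N.subst (Sub.lift σ _)) (P.subst (Sub.lift σ _))
  | _, _, _, σ, .lam M => .lam (M.subst (Sub.lift σ _))
  | _, _, _, σ, .app M N => .app (M.subst σ) (N.subst σ)
  | _, _, _, σ, .val M => .val (M.subst σ)
  | _, _, _, σ, .letIn M N => .letIn (M.subst σ) (N.subst (Sub.lift σ _))

/-- The substitution `Γ, x : B ⟶ Γ` that sends `x` to `N` and fixes the variables of `Γ`. -/
def Sub.single {Base : Type u} {Γ : Ctx Base} {B : Ty Base} (N : Tm Γ B) : Sub (B :: Γ) Γ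
  | _, .zero => N
  | _, .succ v => .var v

/-- The substitution `Γ, z : B ⟶ Γ, x : A` that sends `z` to `N` (which may mention `x`) and
fixes the variables of `Γ`. -/
def Sub.replace {Base : Type u} {Γ : Ctx Base} {A B : Ty Base} (N : Tm (A :: Γ) B) :
    Sub (B :: Γ) (A :: Γ)
  | _, .zero => N
  | _, .succ v => .var (.succ v)

/-- Weakening of a term by one fresh variable. -/
def Tm.weaken {Base : Type u} {Γ : Ctx Base} {A : Ty Base} (B : Ty Base) (M : Tm Γ A) :
    Tm (B :: Γ) A := M.rename (Ren.wk B)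

/-- `M.inst N` is `M[N/x]`, with `x` the most recent variable. -/
def Tm.inst {Base : Type u} {Γ : Ctx Base} {A B : Ty Base} (M : Tm (B :: Γ) A) (N : Tm Γ B) :
    Tm Γ A := M.subst (Sub.single N)

/-- The equational theory: `TmEq M N` is the judgement `Γ ⊢ M = N : A`. It is the least congruence
containing the listed computation and uniqueness rules. -/
inductive TmEq {Base : Type u} : {Γ : Ctx Base} → {A : Ty Base} → Tm Γ A → Tm Γ A → Prop
  -- equivalence relation
  | refl {Γ : Ctx Base} {A : Ty Base} (M : Tm Γ A) : TmEq M M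
  | symm {Γ : Ctx Base} {A : Ty Base} {M N : Tm Γ A} : TmEq M N → TmEq N M
  | trans {Γ : Ctx Base} {A : Ty Base} {M N P : Tm Γ A} : TmEq M N → TmEq N P → TmEq M P
  -- congruence
  | ifte {Γ : Ctx Base} {C : Ty Base} {M M' : Tm Γ Ty.bool} {E₁ E₁' E₀ E₀' : Tm Γ C} :
      TmEq M M' → TmEq E₁ E₁' → TmEq E₀ E₀' → TmEq (.ifte M E₁ E₀) (.ifte M' E₁' E₀')
  | pair {Γ : Ctx Base} {A B : Ty Base} {M M' : Tm Γ A} {N N' : Tm Γ B} :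
      TmEq M M' → TmEq N N' → TmEq (.pair M N) (.pair M' N')
  | fst {Γ : Ctx Base} {A B : Ty Base} {M M' : Tm Γ (Ty.prod A B)} :
      TmEq M M' → TmEq (.fst M) (.fst M')
  | snd {Γ : Ctx Base} {A B : Ty Base} {M M' : Tm Γ (Ty.prod A B)} :
      TmEq M M' → TmEq (.snd M) (.snd M')
  | absurd {Γ : Ctx Base} {C : Ty Base} {M M' : Tm Γ Ty.empty} :
      TmEq M M' → TmEq (.absurd M : Tm Γ C) (.absurd M')
  | inl {Γ : Ctx Base} {A B : Ty Base} {M M' : Tm Γ A} :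
      TmEq M M' → TmEq (.inl M : Tm Γ (Ty.sum A B)) (.inl M')
  | inr {Γ : Ctx Base} {A B : Ty Base} {M M' : Tm Γ B} :
      TmEq M M' → TmEq (.inr M : Tm Γ (Ty.sum A B)) (.inr M')
  | caseOf {Γ : Ctx Base} {A B C : Ty Base} {M M' : Tm Γ (Ty.sum A B)}
      {N N' : Tm (A :: Γ) C} {P P' : Tm (B :: Γ) C} :
      TmEq M M' → TmEq N N' → TmEq P P' → TmEq (.caseOf M N P) (.caseOf M' N' P')
  | lam {Γ : Ctx Base} {A B : Ty Base} {M M' : Tm (A :: Γ) B} :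
      TmEq M M' → TmEq (.lam M) (.lam M')
  | app {Γ : Ctx Base} {A B : Ty Base} {M M' : Tm Γ (Ty.arrow A B)} {N N' : Tm Γ A} :
      TmEq M M' → TmEq N N' → TmEq (.app M N) (.app M' N')
  | val {Γ : Ctx Base} {A : Ty Base} {M M' : Tm Γ A} :
      TmEq M M' → TmEq (.val M) (.val M')
  | letIn {Γ : Ctx Base} {A B : Ty Base} {M M' : Tm Γ (Ty.T A)}
      {N N' : Tm (A :: Γ) (Ty.T B)} :
      TmEq M M' → TmEq N N' → TmEq (.letIn M N) (.letIn M' N')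
  -- unit
  | unit_eta {Γ : Ctx Base} (M : Tm Γ Ty.unit) : TmEq M .star
  -- booleans
  | ifte_tt {Γ : Ctx Base} {C : Ty Base} (E₁ E₀ : Tm Γ C) : TmEq (.ifte .tt E₁ E₀) E₁
  | ifte_ff {Γ : Ctx Base} {C : Ty Base} (E₁ E₀ : Tm Γ C) : TmEq (.ifte .ff E₁ E₀) E₀
  -- products
  | fst_pair {Γ : Ctx Base} {A B : Ty Base} (M : Tm Γ A) (N : Tm Γ B) :
      TmEq (.fst (.pair M N)) M
  | snd_pair {Γ : Ctx Base} {A B : Ty Base} (M : Tm Γ A) (N : Tm Γ B) :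
      TmEq (.snd (.pair M N)) N
  | prod_eta {Γ : Ctx Base} {A B : Ty Base} (M : Tm Γ (Ty.prod A B)) :
      TmEq M (.pair (.fst M) (.snd M))
  -- finite coproducts
  | empty_eta {Γ : Ctx Base} {C : Ty Base} (M : Tm Γ Ty.empty) (N : Tm (Ty.empty :: Γ) C) :
      TmEq (N.inst M) (.absurd M)
  | case_inl {Γ : Ctx Base} {A B C : Ty Base} (M : Tm Γ A)
      (N : Tm (A :: Γ) C) (P : Tm (B :: Γ) C) : TmEq (.caseOf (.inl M) N P) (N.inst M)
  | case_inr {Γ : Ctx Base} {A B C : Ty Base} (M : Tm Γ B)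
      (N : Tm (A :: Γ) C) (P : Tm (B :: Γ) C) : TmEq (.caseOf (.inr M) N P) (P.inst M)
  | sum_eta {Γ : Ctx Base} {A B C : Ty Base} (M : Tm Γ (Ty.sum A B))
      (N : Tm (Ty.sum A B :: Γ) C) :
      TmEq (N.inst M)
        (.caseOf M (N.subst (Sub.replace (.inl (.var .zero))))
          (N.subst (Sub.replace (.inr (.var .zero)))))
  -- functions
  | beta {Γ : Ctx Base} {A B : Ty Base} (M : Tm (A :: Γ) B) (N : Tm Γ A) :
      TmEq (.app (.lam M) N) (M.inst N)
  | eta {Γ : Ctx Base} {A B : Ty Base} (M : Tm Γ (Ty.arrow A B)) :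
      TmEq M (.lam (.app (M.weaken A) (.var .zero)))
  -- computations: `let x = [M] in N` is `N[M/x]`; `let x = M in [x]` is `M`; and
  -- `let y = (let x = M in N) in P` is `let x = M in let y = N in P` (with `x` not free in `P`)
  | let_val {Γ : Ctx Base} {A B : Ty Base} (M : Tm Γ A) (N : Tm (A :: Γ) (Ty.T B)) :
      TmEq (.letIn (.val M) N) (N.inst M)
  | let_eta {Γ : Ctx Base} {A : Ty Base} (M : Tm Γ (Ty.T A)) :
      TmEq (.letIn M (.val (.var .zero))) M
  | let_assoc {Γ : Ctx Base} {A B C : Ty Base} (M : Tm Γ (Ty.T A))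
      (N : Tm (A :: Γ) (Ty.T B)) (P : Tm (B :: Γ) (Ty.T C)) :
      TmEq (.letIn (.letIn M N) P)
        (.letIn M (.letIn N (P.rename (Ren.lift (Ren.wk A) B))))

end MonadicMetalanguage

namespace MonadicMetalanguage

universe v

variable {Base : Type v} {Γ Δ Θ : Ctx Base} {A B : Ty Base}

/-! The proof is by a binary logical relation `Rel` on closed terms. At `bool` it demands that both
sides be provably equal to the same constant; at `T A` it relates everything. The second choice is
sound because the only eliminator of `T`, `letIn`, lands again in a type `T B`, so no computation
can influence a value of another kind of type. The fundamental lemma `Tm.rel_subst` says that every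
term sends related closing substitutions to related terms. Any two closed terms of type `T A` are
related, so the two instances of `M` are related at `bool`, that is, provably equal to a common
constant. Only β-rules, the conditional rules and congruence enter. -/

/-! ### Substitution calculus -/

theorem Ren.lift_comp (ρ : Ren Γ Δ) (τ : Ren Δ Θ) (B : Ty Base) :
    (fun A v => (τ.lift B) A ((ρ.lift B) A v)) = Ren.lift (fun A v => τ A (ρ A v)) B := by
  funext A v
  cases v <;> rfl

theorem Tm.rename_rename (M : Tm Γ A) : ∀ {Δ Θ : Ctx Base} (ρ : Ren Γ Δ) (τ : Ren Δ Θ),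
    (M.rename ρ).rename τ = M.rename (fun A v => τ A (ρ A v)) := by
  induction M with
  | var | star | tt | ff => intros; rfl
  | ifte M E₁ E₀ ihM ih₁ ih₀ => intros; simp only [Tm.rename, ihM, ih₁, ih₀]
  | pair M N ihM ihN | app M N ihM ihN => intros; simp only [Tm.rename, ihM, ihN]
  | fst M ih | snd M ih | absurd M ih | inl M ih | inr M ih | val M ih =>
    intros; simp only [Tm.rename, ih]
  | lam M ih => intros; simp only [Tm.rename, ih, Ren.lift_comp]
  | letIn M N ihM ihN => intros; simp only [Tm.rename, ihM, ihN, Ren.lift_comp]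
  | caseOf M N P ihM ihN ihP => intros; simp only [Tm.rename, ihM, ihN, ihP, Ren.lift_comp]

theorem Sub.lift_comp_ren (ρ : Ren Γ Δ) (σ : Sub Δ Θ) (B : Ty Base) :
    (fun A v => (σ.lift B) A ((ρ.lift B) A v)) = Sub.lift (fun A v => σ A (ρ A v)) B := by
  funext A v
  cases v <;> rfl

theorem Tm.subst_rename (M : Tm Γ A) : ∀ {Δ Θ : Ctx Base} (ρ : Ren Γ Δ) (σ : Sub Δ Θ),
    (M.rename ρ).subst σ = M.subst (fun A v => σ A (ρ A v)) := by
  induction M with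
  | var | star | tt | ff => intros; rfl
  | ifte M E₁ E₀ ihM ih₁ ih₀ => intros; simp only [Tm.rename, Tm.subst, ihM, ih₁, ih₀]
  | pair M N ihM ihN | app M N ihM ihN => intros; simp only [Tm.rename, Tm.subst, ihM, ihN]
  | fst M ih | snd M ih | absurd M ih | inl M ih | inr M ih | val M ih =>
    intros; simp only [Tm.rename, Tm.subst, ih]
  | lam M ih => intros; simp only [Tm.rename, Tm.subst, ih, Sub.lift_comp_ren]
  | letIn M N ihM ihN => intros; simp only [Tm.rename, Tm.subst, ihM, ihN, Sub.lift_comp_ren]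
  | caseOf M N P ihM ihN ihP => intros; simp only [Tm.rename, Tm.subst, ihM, ihN, ihP, Sub.lift_comp_ren]

theorem Ren.lift_comp_sub (σ : Sub Γ Δ) (ρ : Ren Δ Θ) (B : Ty Base) :
    (fun A v => ((σ.lift B) A v).rename (ρ.lift B)) =
      Sub.lift (fun A v => (σ A v).rename ρ) B := by
  funext A v
  cases v with
  | zero => rfl
  | succ v => simp only [Sub.lift, Tm.rename_rename]; rfl

theorem Tm.rename_subst (M : Tm Γ A) : ∀ {Δ Θ : Ctx Base} (σ : Sub Γ Δ) (ρ : Ren Δ Θ),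
    (M.subst σ).rename ρ = M.subst (fun A v => (σ A v).rename ρ) := by
  induction M with
  | var | star | tt | ff => intros; rfl
  | ifte M E₁ E₀ ihM ih₁ ih₀ => intros; simp only [Tm.rename, Tm.subst, ihM, ih₁, ih₀]
  | pair M N ihM ihN | app M N ihM ihN => intros; simp only [Tm.rename, Tm.subst, ihM, ihN]
  | fst M ih | snd M ih | absurd M ih | inl M ih | inr M ih | val M ih =>
    intros; simp only [Tm.rename, Tm.subst, ih]
  | lam M ih => intros; simp only [Tm.rename, Tm.subst, ih, Ren.lift_comp_sub]
  | letIn M N ihM ihN => intros; simp only [Tm.rename, Tm.subst, ihM, ihN, Ren.lift_comp_sub]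
  | caseOf M N P ihM ihN ihP => intros; simp only [Tm.rename, Tm.subst, ihM, ihN, ihP, Ren.lift_comp_sub]

theorem Sub.lift_comp (σ : Sub Γ Δ) (τ : Sub Δ Θ) (B : Ty Base) :
    (fun A v => ((σ.lift B) A v).subst (τ.lift B)) =
      Sub.lift (fun A v => (σ A v).subst τ) B := by
  funext A v
  cases v with
  | zero => rfl
  | succ v => simp only [Sub.lift, Tm.subst_rename, Tm.rename_subst]; rfl

/-- Lifting a substitution weakens its terms, so the binder cases rest on the two mixed laws for
renaming and substitution, proved beforehand. -/
theorem Tm.subst_subst (M : Tm Γ A) : ∀ {Δ Θ : Ctx Base} (σ : Sub Γ Δ) (τ : Sub Δ Θ),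
    (M.subst σ).subst τ = M.subst (fun A v => (σ A v).subst τ) := by
  induction M with
  | var | star | tt | ff => intros; rfl
  | ifte M E₁ E₀ ihM ih₁ ih₀ => intros; simp only [Tm.subst, ihM, ih₁, ih₀]
  | pair M N ihM ihN | app M N ihM ihN => intros; simp only [Tm.subst, ihM, ihN]
  | fst M ih | snd M ih | absurd M ih | inl M ih | inr M ih | val M ih =>
    intros; simp only [Tm.subst, ih]
  | lam M ih => intros; simp only [Tm.subst, ih, Sub.lift_comp]
  | letIn M N ihM ihN => intros; simp only [Tm.subst, ihM, ihN, Sub.lift_comp]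
  | caseOf M N P ihM ihN ihP => intros; simp only [Tm.subst, ihM, ihN, ihP, Sub.lift_comp]

theorem Sub.lift_var (Γ : Ctx Base) (B : Ty Base) :
    Sub.lift (fun A (v : Var Γ A) => Tm.var v) B = fun _ v => Tm.var v := by
  funext A v
  cases v <;> rfl

theorem Tm.subst_var (M : Tm Γ A) : M.subst (fun _ v => Tm.var v) = M := by
  induction M with
  | var | star | tt | ff => rfl
  | ifte M E₁ E₀ ihM ih₁ ih₀ => simp only [Tm.subst, ihM, ih₁, ih₀]
  | pair M N ihM ihN | app M N ihM ihN => simp only [Tm.subst, ihM, ihN]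
  | fst M ih | snd M ih | absurd M ih | inl M ih | inr M ih | val M ih =>
    simp only [Tm.subst, ih]
  | lam M ih => simp only [Tm.subst, ih, Sub.lift_var]
  | letIn M N ihM ihN => simp only [Tm.subst, ihM, ihN, Sub.lift_var]
  | caseOf M N P ihM ihN ihP => simp only [Tm.subst, ihM, ihN, ihP, Sub.lift_var]

/-- Extension of a substitution by a term for the most recent variable. -/
def Sub.cons (N : Tm Δ B) (σ : Sub Γ Δ) : Sub (B :: Γ) Δ
  | _, .zero => N
  | _, .succ v => σ _ v

/-- Identifies a β-reduct with the body under an extended substitution, the form to which the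
induction hypothesis for a binder applies. -/
theorem Tm.inst_subst_lift (M : Tm (B :: Γ) A) (σ : Sub Γ Δ) (N : Tm Δ B) :
    (M.subst (σ.lift B)).inst N = M.subst (Sub.cons N σ) := by
  rw [Tm.inst, Tm.subst_subst]
  congr 1
  funext A v
  cases v with
  | zero => rfl
  -- The weakening made by the lift cancels against the instantiation.
  | succ v => exact (Tm.subst_rename _ _ _).trans (Tm.subst_var _)

/-! ### The logical relation -/

/-- The logical relation on closed terms that observes values up to provable equality and
identifies all computations of the same type. -/
def Rel : (A : Ty Base) → Tm [] A → Tm [] A → Prop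
  | .base _, _, _ => True
  | .unit, _, _ => True
  | .bool, M, N => (TmEq M .tt ∧ TmEq N .tt) ∨ (TmEq M .ff ∧ TmEq N .ff)
  | .prod A B, M, N => Rel A (.fst M) (.fst N) ∧ Rel B (.snd M) (.snd N)
  | .empty, _, _ => False
  | .sum A B, M, N =>
      (∃ P Q, TmEq M (.inl P) ∧ TmEq N (.inl Q) ∧ Rel A P Q) ∨
        (∃ P Q, TmEq M (.inr P) ∧ TmEq N (.inr Q) ∧ Rel B P Q)
  | .arrow A B, M, N => ∀ P Q, Rel A P Q → Rel B (.app M P) (.app N Q)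
  | .T _, _, _ => True

/-- Products and functions are observed through eliminators, which respect provable equality;
booleans and sums absorb it by transitivity. It lets the fundamental lemma pass from a reduct back
to the redex. -/
theorem Rel.congr {A : Ty Base} {M M' N N' : Tm [] A} (hM : TmEq M M') (hN : TmEq N N')
    (h : Rel A M N) : Rel A M' N' := by
  induction A with
  | base | unit | T => trivial
  | empty => exact h
  | bool =>
    exact h.imp (fun h => ⟨hM.symm.trans h.1, hN.symm.trans h.2⟩)
      (fun h => ⟨hM.symm.trans h.1, hN.symm.trans h.2⟩)
  | prod A B ihA ihB => exact ⟨ihA hM.fst hN.fst h.1, ihB hM.snd hN.snd h.2⟩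
  | sum A B =>
    rcases h with ⟨P, Q, hP, hQ, h⟩ | ⟨P, Q, hP, hQ, h⟩
    · exact .inl ⟨P, Q, hM.symm.trans hP, hN.symm.trans hQ, h⟩
    · exact .inr ⟨P, Q, hM.symm.trans hP, hN.symm.trans hQ, h⟩
  | arrow A B _ ihB =>
    exact fun P Q hPQ => ihB (hM.app (.refl P)) (hN.app (.refl Q)) (h P Q hPQ)

/-- Pointwise extension of the logical relation to closing substitutions. -/
def Sub.Rel (σ τ : Sub Γ []) : Prop :=
  ∀ (A : Ty Base) (v : Var Γ A), MonadicMetalanguage.Rel A (σ A v) (τ A v)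

theorem Sub.Rel.cons {σ τ : Sub Γ []} (h : σ.Rel τ) {M N : Tm [] B}
    (hMN : MonadicMetalanguage.Rel B M N) : (Sub.cons M σ).Rel (Sub.cons N τ) := by
  intro A v
  cases v with
  | zero => exact hMN
  | succ v => exact h A v

/-- The fundamental lemma of the logical relation. -/
theorem Tm.rel_subst (M : Tm Γ A) : ∀ {σ τ : Sub Γ []}, σ.Rel τ →
    Rel A (M.subst σ) (M.subst τ) := by
  induction M with
  | var v => exact fun h => h _ v
  -- Here `letIn` needs nothing about its subterms: its type is of the form `T B`.
  | star | val | letIn => exact fun _ => trivial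
  | tt => exact fun _ => .inl ⟨.refl _, .refl _⟩
  | ff => exact fun _ => .inr ⟨.refl _, .refl _⟩
  | ifte M E₁ E₀ ihM ih₁ ih₀ =>
    intro σ τ h
    rcases ihM h with ⟨h₁, h₂⟩ | ⟨h₁, h₂⟩
    · exact (ih₁ h).congr ((TmEq.ifte h₁ (.refl _) (.refl _)).trans (.ifte_tt _ _)).symm
        ((TmEq.ifte h₂ (.refl _) (.refl _)).trans (.ifte_tt _ _)).symm
    · exact (ih₀ h).congr ((TmEq.ifte h₁ (.refl _) (.refl _)).trans (.ifte_ff _ _)).symm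
        ((TmEq.ifte h₂ (.refl _) (.refl _)).trans (.ifte_ff _ _)).symm
  | pair M N ihM ihN =>
    exact fun h => ⟨(ihM h).congr (TmEq.fst_pair _ _).symm (TmEq.fst_pair _ _).symm,
      (ihN h).congr (TmEq.snd_pair _ _).symm (TmEq.snd_pair _ _).symm⟩
  | fst M ih => exact fun h => (ih h).1
  | snd M ih => exact fun h => (ih h).2
  | absurd M ih => exact fun h => (ih h).elim
  | inl M ih => exact fun h => .inl ⟨_, _, .refl _, .refl _, ih h⟩
  | inr M ih => exact fun h => .inr ⟨_, _, .refl _, .refl _, ih h⟩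
  | caseOf M N P ihM ihN ihP =>
    intro σ τ h
    rcases ihM h with ⟨Q, R, hQ, hR, hQR⟩ | ⟨Q, R, hQ, hR, hQR⟩
    -- Both scrutinees are provably injections on the same side, so the same branch is taken with
    -- related arguments.
    · have key := ihN (h.cons hQR)
      rw [← Tm.inst_subst_lift, ← Tm.inst_subst_lift] at key
      exact key.congr ((TmEq.caseOf hQ (.refl _) (.refl _)).trans (.case_inl _ _ _)).symm
        ((TmEq.caseOf hR (.refl _) (.refl _)).trans (.case_inl _ _ _)).symm
    · have key := ihP (h.cons hQR)
      rw [← Tm.inst_subst_lift, ← Tm.inst_subst_lift] at key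
      exact key.congr ((TmEq.caseOf hQ (.refl _) (.refl _)).trans (.case_inr _ _ _)).symm
        ((TmEq.caseOf hR (.refl _) (.refl _)).trans (.case_inr _ _ _)).symm
  | lam M ih =>
    intro σ τ h P Q hPQ
    have key := ih (h.cons hPQ)
    rw [← Tm.inst_subst_lift, ← Tm.inst_subst_lift] at key
    exact key.congr (TmEq.beta _ _).symm (TmEq.beta _ _).symm
  | app M N ihM ihN => exact fun h => ihM h _ _ (ihN h)

/-- Closed boolean terms related by the logical relation are provably equal. -/
theorem Rel.tmEq {M N : Tm ([] : Ctx Base) .bool} (h : Rel .bool M N) : TmEq M N :=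
  h.elim (fun h => h.1.trans h.2.symm) (fun h => h.1.trans h.2.symm)

end MonadicMetalanguage

theorem mainTheorem5 {Base : Type*} (A : MonadicMetalanguage.Ty Base)
    (hA : Nonempty (MonadicMetalanguage.Tm [] A))
    (M : MonadicMetalanguage.Tm [MonadicMetalanguage.Ty.T A] MonadicMetalanguage.Ty.bool)
    (E E' : MonadicMetalanguage.Tm [] (MonadicMetalanguage.Ty.T A)) :
    MonadicMetalanguage.TmEq (M.inst E) (M.inst E') := by
  -- The sole variable has type `T A`, where the relation holds by definition.
  refine (M.rel_subst fun B v => ?_).tmEq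
  cases v with
  | zero => trivial
  | succ v => cases v
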